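/- All graphs are finite, simple and undirected. For a connected graph $G$ on vertices $v_1,\dots,v_n$ with distances $d_{ij}=d_G(v_i,v_j)$, let $RD(G)$ be the $n\times n$ matrix with entries $1/d_{ij}$ for $i\ne j$ and $0$ on the diagonal, let $RT(G)$ be the diagonal matrix whose $i$-th diagonal entry is $\sum_{j\neq i} 1/d_{ij}$, and put $$RD_\alpha(G)=\alpha\,RT(G)+(1-\alpha)\,RD(G)\quad(0\le\alpha\le 1),\qquad RQ(G)=RT(G)+RD(G).$$ For a real symmetric matrix $M$ let $\rho(M)$ denote its largest eigenvalue. The vertex connectivity of $G$ is the minimum number of vertices whose removal leaves a disconnected graph or a single vertex (so that it equals $n-1$ for the complete graph $K_n$). Write $G_1\cup G_2$ for the disjoint union of two graphs, and $G_1\vee G_2$ for their join, obtained from $G_1\cup G_2$ by adding all edges between $G_1$ and $G_2$. **Theorem.** Let $n$ and $r$ be integers with $1\le r\le n-2$. The graph $G^*=K_r\vee(K_1\cup K_{n-r-1})$ is a connected graph of order $n$ with vertex connectivity $r$. For every real $\alpha$ with $0\le\alpha<1$, and every connected graph $G$ of order $n$ with vertex connectivity $r$, $$\rho(RD_\alpha(G))\le\rho(RD_\alpha(G^*)),$$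 with equality if and only if $G$ is isomorphic to $G^*$. Likewise, for every such $G$, $\rho(RQ(G))\le\rho(RQ(G^*))$, with equality if and only if $G$ is isomorphic to $G^*$. -/

import Mathlib

namespace RecipDist

open scoped Classical in
/-- The largest real eigenvalue `λ₁(M)` of a real square matrix `M`; for the symmetric matrices
considered here the eigenvalues are real and `λ₁(M)` is called the spectral radius `ρ(M)`.
That the supremum is attained is `isGreatest_rho` below. -/
noncomputable def rho {V : Type*} [Fintype V] (M : Matrix V V ℝ) : ℝ :=
  sSup {μ : ℝ | Module.End.HasEigenvalue (Matrix.toLin' M) μ}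

open scoped Classical in
theorem isGreatest_rho {V : Type*} [Fintype V] [Nonempty V] {M : Matrix V V ℝ}
    (hM : M.IsSymm) :
    IsGreatest {μ : ℝ | Module.End.HasEigenvalue (Matrix.toLin' M) μ} (rho M) := by
  have hH : M.IsHermitian := by
    rw [Matrix.IsHermitian, Matrix.conjTranspose_eq_transpose_of_trivial]; exact hM
  have hset : {μ : ℝ | Module.End.HasEigenvalue (Matrix.toLin' M) μ} =
      Set.range hH.eigenvalues := by
    rw [← hH.spectrum_real_eq_range_eigenvalues]
    ext μ
    rw [Set.mem_ofPred_eq, Module.End.hasEigenvalue_iff_mem_spectrum, Matrix.spectrum_toLin']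
  have hfin := Set.finite_range hH.eigenvalues
  have hne := Set.range_nonempty hH.eigenvalues
  rw [rho, hset]
  exact ⟨hne.csSup_mem hfin, fun x hx => le_csSup hfin.bddAbove hx⟩

section Matrices

variable {V : Type*} [Fintype V] [DecidableEq V]

/-- The reciprocal distance (Harary) matrix `RD(G)`. -/
noncomputable def RD (G : SimpleGraph V) : Matrix V V ℝ :=
  Matrix.of fun u v => if u = v then 0 else 1 / (G.dist u v : ℝ)

/-- The reciprocal transmission of a vertex: the sum of the reciprocal distances to all
other vertices. -/
noncomputable def RTr (G : SimpleGraph V) (u : V) : ℝ :=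
  ∑ v ∈ Finset.univ.erase u, 1 / (G.dist u v : ℝ)

/-- The diagonal matrix `RT(G)` of the reciprocal transmissions. -/
noncomputable def RT (G : SimpleGraph V) : Matrix V V ℝ :=
  Matrix.diagonal (RTr G)

/-- The generalized reciprocal distance matrix `RD_α(G) = α RT(G) + (1 - α) RD(G)`. -/
noncomputable def RDα (α : ℝ) (G : SimpleGraph V) : Matrix V V ℝ :=
  α • RT G + (1 - α) • RD G

/-- The reciprocal distance signless Laplacian matrix `RQ(G) = RT(G) + RD(G)`. -/
noncomputable def RQ (G : SimpleGraph V) : Matrix V V ℝ :=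
  RT G + RD G

end Matrices

/-- The vertex connectivity `κ(G)`: the minimum number of vertices whose removal leaves a
disconnected graph or at most one vertex (so that `κ(K_n) = n - 1`). -/
noncomputable def vertexConnectivity {V : Type*} [Fintype V] (G : SimpleGraph V) : ℕ :=
  sInf {k : ℕ | ∃ S : Finset V, S.card = k ∧
    (¬ (G.induce {v : V | v ∉ S}).Preconnected ∨ Fintype.card V ≤ S.card + 1)}

/-- The join `G ∨ H` of two graphs: their disjoint union together with all edges between
the vertices of `G` and the vertices of `H`. -/
def join {V W : Type*} (G : SimpleGraph V) (H : SimpleGraph W) : SimpleGraph (V ⊕ W) :=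
  SimpleGraph.sum G H ⊔ completeBipartiteGraph V W

/-- The graph `K_r ∨ (K_1 ∪ K_{n-r-1})`, of order `n` when `r + 1 ≤ n`. -/
def extremalGraph (n r : ℕ) : SimpleGraph (Fin r ⊕ (Fin 1 ⊕ Fin (n - r - 1))) :=
  join (⊤ : SimpleGraph (Fin r))
    (SimpleGraph.sum (⊤ : SimpleGraph (Fin 1)) (⊤ : SimpleGraph (Fin (n - r - 1))))

end RecipDist

/-!
The matrices `RD_α(G)` and `RQ(G)` are both of the form `M(G) = a RT(G) + b RD(G)` with `a ≥ 0` and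
`b > 0` (`harary a b G`), and all such matrices are treated at once.

Twice the quadratic form of `M(G)` at `x` is the sum over ordered pairs of vertices of
`g(u, v) / d(u, v)`, where `g(u, v) = a (x_u² + x_v²) + 2 b x_u x_v` (`pairForm`). For `x > 0` the
weight `g` is positive, and a pair at distance at least two contributes at most `g(u, v) / 2`.
So four times the quadratic form is at most the sum of `g` over all pairs plus its sum over the
adjacent pairs (`adjSum g G`), with equality for graphs of diameter at most two.

Let `x` be a positive eigenvector of `M(G)` for its largest eigenvalue
(`exists_pos_harary_mulVec_eq`). A minimum vertex cut of `G` leaves vertex sets `A` and `B` with no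
edges between them (`exists_le_splitGraph`). If neither is a single vertex, take a vertex `c` of
`A ∪ B` with `x_c` minimal, say `c ∈ A`. Adding all edges except those between `c` and
`(A ∪ B) \ {c}` gives a copy `H` of the extremal graph. This increases the adjacency sum strictly:
`G` misses all pairs in `A × B`; among them those containing `c` are also missed by `H`, while
each remaining pair `{c, u}` missed by `H`, with `u ∈ A`, weighs no more than any single one of the
pairs `{v, u}` with `v ∈ B`, of which there are at least two
(`adjSum_splitGraph_lt`). If `A` or `B` is a single
vertex `c`, then `G` is already a subgraph of the `H` defined by `c`. Hence
`adjSum g G ≤ adjSum g H`, with equality only for `G = H`; by the Rayleigh principle for `M(H)`,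
whose diameter is two, this gives `ρ(M(G)) ≤ ρ(M(H))` and the case of equality
(`rho_harary_le_extremalGraph`).
-/

namespace RecipDist

open Finset Matrix

/-! ### Rayleigh quotients and the largest eigenvalue -/

section Rayleigh

variable {V : Type*} [Fintype V]

/-- The Rayleigh principle in its sharpest form, from which both the bound on the quadratic form
and its equality case follow. -/
theorem posSemidef_rho_smul_one_sub [DecidableEq V] {M : Matrix V V ℝ} (hM : M.IsSymm) :
    (rho M • (1 : Matrix V V ℝ) - M).PosSemidef := by
  have hN : (rho M • (1 : Matrix V V ℝ) - M).IsHermitian := by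
    rw [IsHermitian, conjTranspose_eq_transpose_of_trivial, transpose_sub, transpose_smul,
      transpose_one, hM]
  rw [hN.posSemidef_iff_eigenvalues_nonneg]
  intro i
  have : Nonempty V := ⟨i⟩
  set v : V → ℝ := (hN.eigenvectorBasis i).ofLp with hv
  have h := hN.mulVec_eigenvectorBasis i
  have hv0 : v ≠ 0 := by
    intro h0
    exact hN.eigenvectorBasis.orthonormal.ne_zero i (by ext j; exact congrFun h0 j)
  have hMv : M *ᵥ v = (rho M - hN.eigenvalues i) • v := by
    rw [sub_mulVec, smul_mulVec, one_mulVec] at h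
    rw [sub_smul, ← h, sub_sub_cancel]
  have hmem := (isGreatest_rho hM).2
    (Module.End.hasEigenvalue_of_hasEigenvector (x := v) (μ := rho M - hN.eigenvalues i)
      ⟨Module.End.mem_eigenspace_iff.2 ((@toLin'_apply _ _ _ _ _ _ M v).trans hMv), hv0⟩)
  show 0 ≤ hN.eigenvalues i
  linarith

theorem dotProduct_mulVec_le_rho [DecidableEq V] {M : Matrix V V ℝ} (hM : M.IsSymm) (x : V → ℝ) :
    x ⬝ᵥ M *ᵥ x ≤ rho M * (x ⬝ᵥ x) := by
  have h := (posSemidef_rho_smul_one_sub hM).dotProduct_mulVec_nonneg x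
  simp only [star_trivial, sub_mulVec, smul_mulVec, one_mulVec, dotProduct_sub, dotProduct_smul,
    smul_eq_mul] at h
  linarith

theorem mulVec_eq_rho_smul [DecidableEq V] {M : Matrix V V ℝ} (hM : M.IsSymm) {x : V → ℝ}
    (hx : rho M * (x ⬝ᵥ x) ≤ x ⬝ᵥ M *ᵥ x) : M *ᵥ x = rho M • x := by
  have h0 : star x ⬝ᵥ (rho M • (1 : Matrix V V ℝ) - M) *ᵥ x = 0 := by
    simp only [star_trivial, sub_mulVec, smul_mulVec, one_mulVec, dotProduct_sub, dotProduct_smul,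
      smul_eq_mul]
    linarith [dotProduct_mulVec_le_rho hM x]
  have h := ((posSemidef_rho_smul_one_sub hM).dotProduct_mulVec_zero_iff x).1 h0
  rw [sub_mulVec, smul_mulVec, one_mulVec, sub_eq_zero] at h
  exact h.symm

/-- The Perron vector: a symmetric matrix with nonnegative entries that are positive off the
diagonal has a positive eigenvector for its largest eigenvalue. -/
theorem exists_pos_mulVec_eq_rho_smul [Nonempty V] {M : Matrix V V ℝ} (hM : M.IsSymm)
    (hnn : ∀ u v, 0 ≤ M u v) (hpos : ∀ u v, u ≠ v → 0 < M u v) :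
    ∃ x : V → ℝ, (∀ v, 0 < x v) ∧ M *ᵥ x = rho M • x := by
  classical
  obtain ⟨y, hy, hy0⟩ := Module.End.HasEigenvalue.exists_hasEigenvector (isGreatest_rho hM).1
  have hMy : M *ᵥ y = rho M • y := by
    have h := Module.End.mem_eigenspace_iff.1 hy
    rwa [toLin'_apply] at h
  -- Taking absolute values does not decrease the quadratic form, so `|y|` is again extremal.
  have habs : M *ᵥ (fun v => |y v|) = rho M • (fun v => |y v|) := by
    apply mulVec_eq_rho_smul hM
    have h1 : (fun v => |y v|) ⬝ᵥ (fun v => |y v|) = y ⬝ᵥ y := by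
      simp [dotProduct]
    have h2 : rho M * (y ⬝ᵥ y) = y ⬝ᵥ M *ᵥ y := by
      rw [hMy, dotProduct_smul, smul_eq_mul]
    rw [h1, h2]
    simp only [dotProduct, mulVec, mul_sum]
    refine sum_le_sum fun u _ => sum_le_sum fun v _ => ?_
    calc y u * (M u v * y v) ≤ |y u * (M u v * y v)| := le_abs_self _
      _ = |y u| * (M u v * |y v|) := by rw [abs_mul, abs_mul, abs_of_nonneg (hnn u v)]
  refine ⟨fun v => |y v|, fun u => ?_, habs⟩
  obtain ⟨w, hw⟩ := Function.ne_iff.1 hy0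
  refine abs_pos.2 fun hu => ?_
  have hwu : u ≠ w := fun h => hw (h ▸ hu)
  have h := congrFun habs u
  simp only [mulVec, dotProduct, Pi.smul_apply, hu, abs_zero, smul_zero] at h
  have := (sum_eq_zero_iff_of_nonneg fun v _ => mul_nonneg (hnn u v) (abs_nonneg (y v))).1 h w
    (mem_univ w)
  exact (mul_pos (hpos u w hwu) (abs_pos.2 hw)).ne' this

theorem rho_submatrix_equiv {W : Type*} [Fintype W] (M : Matrix W W ℝ) (e : V ≃ W) :
    rho (M.submatrix e e) = rho M := by
  classical
  have key : ∀ μ : ℝ, Module.End.HasEigenvalue (Matrix.toLin' (M.submatrix e e)) μ ↔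
      Module.End.HasEigenvalue (Matrix.toLin' M) μ := by
    intro μ
    rw [Module.End.hasEigenvalue_iff_mem_spectrum, Module.End.hasEigenvalue_iff_mem_spectrum,
      Matrix.spectrum_toLin', Matrix.spectrum_toLin',
      ← AlgEquiv.spectrum_eq (Matrix.reindexAlgEquiv ℝ ℝ e.symm) M]
    rfl
  unfold rho
  congr 1
  ext μ
  have := key μ
  simp only [Set.mem_ofPred_eq]
  convert this using 2

end Rayleigh

/-! ### The matrices `a • RT G + b • RD G` -/

section Matrices

variable {V : Type*}

theorem dist_map_le {W : Type*} {G : SimpleGraph V} {H : SimpleGraph W} (f : G →g H) {u v : V}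
    (h : G.Reachable u v) : H.dist (f u) (f v) ≤ G.dist u v := by
  obtain ⟨p, hp⟩ := h.exists_walk_length_eq_dist
  rw [← hp, ← p.length_map f]
  exact SimpleGraph.dist_le _

theorem dist_iso {W : Type*} {G : SimpleGraph V} {H : SimpleGraph W} (e : G ≃g H) (u v : V) :
    H.dist (e u) (e v) = G.dist u v := by
  by_cases h : G.Reachable u v
  · refine le_antisymm (dist_map_le e.toHom h) ?_
    simpa using dist_map_le e.symm.toHom (h.map e.toHom)
  · rw [SimpleGraph.dist_eq_zero_of_not_reachable h,
      SimpleGraph.dist_eq_zero_of_not_reachable (mt e.reachable_iff.1 h)]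

theorem one_div_dist_le (G : SimpleGraph V) [DecidableEq V] [DecidableRel G.Adj] (u v : V) :
    1 / (G.dist u v : ℝ) ≤ ((if u ≠ v then 1 else 0) + if G.Adj u v then 1 else 0) / 2 := by
  by_cases huv : u = v
  · simp [huv]
  by_cases hadj : G.Adj u v
  · simp [huv, hadj, SimpleGraph.dist_eq_one_iff_adj.2 hadj]
  by_cases hr : G.Reachable u v
  · have h2 : (2 : ℝ) ≤ G.dist u v := by
      exact_mod_cast hr.one_lt_dist_of_ne_of_not_adj huv hadj
    simpa [huv, hadj] using inv_anti₀ two_pos h2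
  · simp [huv, hadj, SimpleGraph.dist_eq_zero_of_not_reachable hr]

theorem one_div_dist_eq (G : SimpleGraph V) [DecidableEq V] [DecidableRel G.Adj]
    (hc : ∀ u v, u ≠ v → ¬ G.Adj u v → ∃ c, G.Adj u c ∧ G.Adj c v) (u v : V) :
    1 / (G.dist u v : ℝ) = ((if u ≠ v then 1 else 0) + if G.Adj u v then 1 else 0) / 2 := by
  by_cases huv : u = v
  · simp [huv]
  by_cases hadj : G.Adj u v
  · simp [huv, hadj, SimpleGraph.dist_eq_one_iff_adj.2 hadj]
  obtain ⟨c, h1, h2⟩ := hc u v huv hadj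
  let p : G.Walk u v := .cons h1 (.cons h2 .nil)
  have hle : G.dist u v ≤ 2 := SimpleGraph.dist_le p
  have hlt := (p.reachable).one_lt_dist_of_ne_of_not_adj huv hadj
  have : G.dist u v = 2 := by omega
  simp [huv, hadj, this]

/-- The diagonal needs no separate treatment, since `dist u u = 0` and `1 / 0 = 0`. -/
theorem RD_apply [DecidableEq V] (G : SimpleGraph V) (u v : V) : RD G u v = 1 / (G.dist u v : ℝ) := by
  by_cases h : u = v <;> simp [RD, h]

variable [Fintype V] [DecidableEq V] {a b : ℝ} {G : SimpleGraph V}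

/-- The common generalization `a RT(G) + b RD(G)` of `RD_α(G)` and `RQ(G)`. -/
noncomputable def harary (a b : ℝ) (G : SimpleGraph V) : Matrix V V ℝ :=
  a • RT G + b • RD G

theorem RTr_eq_sum (G : SimpleGraph V) (u : V) : RTr G u = ∑ v, 1 / (G.dist u v : ℝ) := by
  rw [RTr, ← add_sum_erase _ _ (mem_univ u)]
  simp

theorem harary_apply (a b : ℝ) (G : SimpleGraph V) (u v : V) :
    harary a b G u v = a * (if u = v then RTr G u else 0) + b * (1 / (G.dist u v : ℝ)) := by
  rw [← RD_apply, ← diagonal_apply]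
  rfl

theorem harary_isSymm (a b : ℝ) (G : SimpleGraph V) : (harary a b G).IsSymm := by
  ext u v
  rw [transpose_apply, harary_apply, harary_apply, G.dist_comm]
  by_cases h : u = v
  · simp [h]
  · simp [h, Ne.symm h]

theorem rho_harary_iso {W : Type*} [Fintype W] [DecidableEq W] {H : SimpleGraph W}
    (a b : ℝ) (e : G ≃g H) : rho (harary a b G) = rho (harary a b H) := by
  rw [← rho_submatrix_equiv (harary a b H) e.toEquiv]
  congr 1
  ext u v
  have hT : RTr H (e u) = RTr G u := by
    rw [RTr_eq_sum, RTr_eq_sum, ← e.toEquiv.sum_comp]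
    exact sum_congr rfl fun w _ => by rw [← dist_iso e u w]; rfl
  have he : ∀ u, e.toEquiv u = e u := fun _ => rfl
  simp only [submatrix_apply, harary_apply, he, dist_iso, hT, EmbeddingLike.apply_eq_iff_eq]

/-- The contribution `a (x_u² + x_v²) + 2 b x_u x_v` of a pair of vertices at distance one to the
quadratic form of `harary a b G`. -/
def pairForm (a b : ℝ) (x : V → ℝ) (u v : V) : ℝ :=
  a * (x u ^ 2 + x v ^ 2) + 2 * b * (x u * x v)

theorem two_mul_dotProduct_harary_mulVec (a b : ℝ) (G : SimpleGraph V) (x : V → ℝ) :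
    2 * (x ⬝ᵥ harary a b G *ᵥ x) =
      ∑ u, ∑ v, 1 / (G.dist u v : ℝ) * pairForm a b x u v := by
  have h1 : x ⬝ᵥ harary a b G *ᵥ x =
      ∑ u, ∑ v, 1 / (G.dist u v : ℝ) * (a * x u ^ 2 + b * (x u * x v)) := by
    simp only [dotProduct]
    refine sum_congr rfl fun u _ => ?_
    simp only [mulVec, dotProduct, harary_apply, add_mul, mul_ite, ite_mul, sum_add_distrib,
      mul_zero, zero_mul, sum_ite_eq, mem_univ, if_true, mul_add, RTr_eq_sum, mul_sum, sum_mul]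
    congr 1 <;> exact sum_congr rfl fun v _ => by ring
  have h2 : x ⬝ᵥ harary a b G *ᵥ x =
      ∑ u, ∑ v, 1 / (G.dist u v : ℝ) * (a * x v ^ 2 + b * (x u * x v)) := by
    rw [h1, sum_comm]
    exact sum_congr rfl fun u _ => sum_congr rfl fun v _ => by rw [G.dist_comm, mul_comm (x v)]
  rw [two_mul]
  nth_rw 1 [h1]
  rw [h2]
  simp only [← sum_add_distrib]
  exact sum_congr rfl fun u _ => sum_congr rfl fun v _ => by rw [pairForm]; ring

theorem exists_pos_harary_mulVec_eq [Nonempty V] (hG : G.Connected) (ha : 0 ≤ a) (hb : 0 < b) :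
    ∃ x : V → ℝ, (∀ v, 0 < x v) ∧ harary a b G *ᵥ x = rho (harary a b G) • x := by
  have hT : ∀ u, 0 ≤ RTr G u := fun u => by rw [RTr]; positivity
  refine exists_pos_mulVec_eq_rho_smul (harary_isSymm a b G) (fun u v => ?_) fun u v huv => ?_
  · rw [harary_apply]
    have := hT u
    split_ifs <;> positivity
  · rw [harary_apply, if_neg huv]
    have : 0 < (G.dist u v : ℝ) := Nat.cast_pos.2 (hG.pos_dist_of_ne huv)
    positivity

end Matrices

/-! ### Complete graphs with the edges between two sets removed -/

section Split

variable {V : Type*}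

/-- The graph on `V` in which two distinct vertices are adjacent unless one lies in `A` and the
other in `B`: for disjoint `A` and `B`, this is the join of the complete graph on the remaining
vertices with the disjoint union of the complete graphs on `A` and `B`. -/
def splitGraph (A B : Finset V) : SimpleGraph V where
  Adj u v := u ≠ v ∧ ¬ (u ∈ A ∧ v ∈ B) ∧ ¬ (u ∈ B ∧ v ∈ A)
  symm := ⟨fun _ _ h => ⟨h.1.symm, fun h' => h.2.2 h'.symm, fun h' => h.2.1 h'.symm⟩⟩
  loopless := ⟨fun _ h => h.1 rfl⟩

theorem splitGraph_adj {A B : Finset V} {u v : V} :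
    (splitGraph A B).Adj u v ↔ u ≠ v ∧ ¬ (u ∈ A ∧ v ∈ B) ∧ ¬ (u ∈ B ∧ v ∈ A) := Iff.rfl

theorem splitGraph_comm (A B : Finset V) : splitGraph A B = splitGraph B A := by
  ext u v
  simp only [splitGraph_adj]
  tauto

variable [Fintype V]

/-- A vertex cut of minimum size presents a graph as a subgraph of a `splitGraph`. -/
theorem exists_le_splitGraph [DecidableEq V] {G : SimpleGraph V}
    (h : vertexConnectivity G + 2 ≤ Fintype.card V) :
    ∃ A B : Finset V, Disjoint A B ∧ A.Nonempty ∧ B.Nonempty ∧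
      #(A ∪ B) + vertexConnectivity G = Fintype.card V ∧ G ≤ splitGraph A B := by
  classical
  have hne : {k : ℕ | ∃ S : Finset V, S.card = k ∧ (¬ (G.induce {v : V | v ∉ S}).Preconnected ∨
      Fintype.card V ≤ S.card + 1)}.Nonempty :=
    ⟨_, univ, rfl, Or.inr (by rw [card_univ]; omega)⟩
  obtain ⟨S, hS, hS'⟩ := Nat.sInf_mem hne
  change #S = vertexConnectivity G at hS
  replace hS' := hS'.resolve_right (by omega)
  simp only [SimpleGraph.Preconnected, not_forall] at hS'
  obtain ⟨x, y, hxy⟩ := hS'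
  set K := G.induce {v : V | v ∉ S}
  let A : Finset V := univ.filter fun v => ∃ h : v ∉ S, K.Reachable x ⟨v, h⟩
  let B : Finset V := univ.filter fun v => ∃ h : v ∉ S, ¬ K.Reachable x ⟨v, h⟩
  have hA : ∀ {v}, v ∈ A ↔ ∃ h : v ∉ S, K.Reachable x ⟨v, h⟩ := by simp [A]
  have hB : ∀ {v}, v ∈ B ↔ ∃ h : v ∉ S, ¬ K.Reachable x ⟨v, h⟩ := by simp [B]
  have hAB : A ∪ B = Sᶜ := by
    ext v
    rw [mem_union, hA, hB, mem_compl]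
    constructor
    · rintro (⟨h, -⟩ | ⟨h, -⟩) <;> exact h
    · intro h
      by_cases hr : K.Reachable x ⟨v, h⟩
      exacts [Or.inl ⟨h, hr⟩, Or.inr ⟨h, hr⟩]
  have hsep : ∀ {u v}, G.Adj u v → ¬ (u ∈ A ∧ v ∈ B) := by
    rintro u v huv ⟨hu, hv⟩
    obtain ⟨hu, hu'⟩ := hA.1 hu
    obtain ⟨hv, hv'⟩ := hB.1 hv
    have : K.Adj ⟨u, hu⟩ ⟨v, hv⟩ := huv
    exact hv' (hu'.trans this.reachable)
  refine ⟨A, B, ?_, ⟨x, hA.2 ⟨x.2, .refl _⟩⟩, ⟨y, hB.2 ⟨y.2, hxy⟩⟩, ?_, fun u v huv =>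
    ⟨huv.ne, hsep huv, fun h => hsep huv.symm h.symm⟩⟩
  · rw [disjoint_left]
    intro v hv hv'
    exact (hB.1 hv').2 (hA.1 hv).2
  · rw [hAB, ← hS, add_comm, card_add_card_compl]

open scoped Classical in
/-- The sum of a weight over the ordered pairs of adjacent vertices. -/
noncomputable def adjSum (g : V → V → ℝ) (G : SimpleGraph V) : ℝ :=
  ∑ u, ∑ v, if G.Adj u v then g u v else 0

theorem adjSum_le_of_le {g : V → V → ℝ} (hg : ∀ u v, 0 < g u v) {G H : SimpleGraph V}
    (h : G ≤ H) : adjSum g G ≤ adjSum g H := by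
  refine sum_le_sum fun u _ => sum_le_sum fun v _ => ?_
  by_cases hG : G.Adj u v
  · simp [hG, h hG]
  · rw [if_neg hG]
    split_ifs
    exacts [(hg u v).le, le_rfl]

theorem eq_of_le_of_adjSum_eq {g : V → V → ℝ} (hg : ∀ u v, 0 < g u v) {G H : SimpleGraph V}
    (h : G ≤ H) (he : adjSum g G = adjSum g H) : G = H := by
  classical
  refine le_antisymm h fun u v huv => ?_
  by_contra hG
  have hle : ∀ u v, (if G.Adj u v then g u v else 0) ≤ if H.Adj u v then g u v else 0 := by
    intro u v
    by_cases hG : G.Adj u v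
    · simp [hG, h hG]
    · rw [if_neg hG]
      split_ifs
      exacts [(hg u v).le, le_rfl]
  refine he.not_lt ?_
  unfold adjSum
  refine sum_lt_sum (fun u _ => sum_le_sum fun v _ => by convert hle u v)
    ⟨u, mem_univ u, sum_lt_sum (fun v _ => by convert hle u v) ⟨v, mem_univ v, ?_⟩⟩
  simpa [hG, huv] using hg u v

theorem adjSum_splitGraph {g : V → V → ℝ} (hg : ∀ u v, g u v = g v u) {A B : Finset V}
    (hAB : Disjoint A B) :
    adjSum g (splitGraph A B) = adjSum g ⊤ - 2 * ∑ u ∈ A, ∑ v ∈ B, g u v := by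
  classical
  have h1 : ∀ A B : Finset V, ∑ u ∈ A, ∑ v ∈ B, g u v =
      ∑ u, ∑ v, if u ∈ A ∧ v ∈ B then g u v else 0 := by
    intro A B
    rw [← sum_subset (subset_univ A) fun u _ hu => sum_eq_zero fun v _ => if_neg fun h => hu h.1]
    refine sum_congr rfl fun u hu => ?_
    rw [← sum_subset (subset_univ B) fun v _ hv => if_neg fun h => hv h.2]
    exact sum_congr rfl fun v hv => (if_pos ⟨hu, hv⟩).symm
  have h2 : ∑ u ∈ A, ∑ v ∈ B, g u v = ∑ u ∈ B, ∑ v ∈ A, g u v := by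
    rw [sum_comm]
    exact sum_congr rfl fun u _ => sum_congr rfl fun v _ => hg v u
  rw [two_mul]
  nth_rw 2 [h2]
  rw [h1, h1, eq_sub_iff_add_eq, adjSum, adjSum]
  simp only [← sum_add_distrib]
  refine sum_congr rfl fun u _ => sum_congr rfl fun v _ => ?_
  have hd := disjoint_left.1 hAB
  by_cases huv : u = v
  · subst huv
    have : ¬ (u ∈ A ∧ u ∈ B) := fun h => hd h.1 h.2
    have : ¬ (u ∈ B ∧ u ∈ A) := fun h => hd h.2 h.1
    simp [*]
  · by_cases hp : u ∈ A ∧ v ∈ B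
    · simp [splitGraph_adj, huv, hp, hd hp.1]
    · by_cases hq : u ∈ B ∧ v ∈ A <;> simp [splitGraph_adj, huv, hp, hq]

/-- Isolating inside `A ∪ B` a vertex `c` of `A` that minimizes the weight loses less than
separating `A` from `B`, because the pairs `{c, u}` with `u ∈ A` are outweighed by the pairs
`{v, u}` with `v ∈ B`. -/
theorem adjSum_splitGraph_lt [DecidableEq V] {g : V → V → ℝ} (hg : ∀ u v, g u v = g v u)
    (hpos : ∀ u v, 0 < g u v) {A B : Finset V} (hAB : Disjoint A B) {c : V} (hc : c ∈ A)
    (hmin : ∀ v ∈ B, ∀ u, g c u ≤ g v u) (hA : 1 < #A) (hB : 1 < #B) :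
    adjSum g (splitGraph A B) < adjSum g (splitGraph {c} ((A ∪ B).erase c)) := by
  have hcB : c ∉ B := disjoint_left.1 hAB hc
  have hunion : (A ∪ B).erase c = A.erase c ∪ B := by
    rw [erase_union_distrib, erase_eq_of_notMem hcB]
  rw [adjSum_splitGraph hg hAB, adjSum_splitGraph hg (by simp), sum_singleton, hunion,
    sum_union (hAB.mono_left (erase_subset c A)), ← add_sum_erase A _ hc]
  have hlt : ∑ u ∈ A.erase c, g c u < ∑ u ∈ A.erase c, ∑ v ∈ B, g u v := by
    refine sum_lt_sum_of_nonempty ?_ fun u _ => ?_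
    · rw [← card_pos, card_erase_of_mem hc]
      omega
    · obtain ⟨v, hv, w, hw, hvw⟩ := one_lt_card.1 hB
      calc g c u ≤ g u v := (hmin v hv u).trans_eq (hg v u)
        _ < ∑ v ∈ B, g u v :=
          single_lt_sum hvw.symm hv hw (hpos u w) fun k _ _ => (hpos u k).le
  linarith

/-- Among the graphs with a given cut, and for a weight that is monotone in its first argument
with respect to some ranking `x` of the vertices, the adjacency sum is largest for a graph in
which one vertex is cut off, and only there. -/
theorem exists_adjSum_le_splitGraph [DecidableEq V] {g : V → V → ℝ} {x : V → ℝ}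
    (hg : ∀ u v, g u v = g v u) (hpos : ∀ u v, 0 < g u v)
    (hmono : ∀ u v w, x u ≤ x v → g u w ≤ g v w) {G : SimpleGraph V} {A B : Finset V}
    (hAB : Disjoint A B) (hA : A.Nonempty) (hB : B.Nonempty) (hG : G ≤ splitGraph A B) :
    ∃ c ∈ A ∪ B, adjSum g G ≤ adjSum g (splitGraph {c} ((A ∪ B).erase c)) ∧
      (adjSum g G = adjSum g (splitGraph {c} ((A ∪ B).erase c)) →
        G = splitGraph {c} ((A ∪ B).erase c)) := by
  obtain ⟨c, hc, hmin⟩ := exists_min_image (A ∪ B) x (hA.mono subset_union_left)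
  wlog hcA : c ∈ A generalizing A B
  · have := this hAB.symm hB hA (splitGraph_comm A B ▸ hG) (union_comm A B ▸ hc)
      (union_comm A B ▸ hmin) ((mem_union.1 hc).resolve_left hcA)
    rwa [union_comm B A] at this
  -- If a side is a single vertex, `G` is already contained in the graph that isolates it.
  have hsingle : ∀ A B : Finset V, Disjoint A B → G ≤ splitGraph A B → #A = 1 →
      ∃ c ∈ A ∪ B, adjSum g G ≤ adjSum g (splitGraph {c} ((A ∪ B).erase c)) ∧
        (adjSum g G = adjSum g (splitGraph {c} ((A ∪ B).erase c)) →
          G = splitGraph {c} ((A ∪ B).erase c)) := by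
    intro A B hAB hG hA1
    obtain ⟨c, rfl⟩ := card_eq_one.1 hA1
    have hcB : c ∉ B := disjoint_singleton_left.1 hAB
    refine ⟨c, by simp, ?_⟩
    rw [singleton_union, erase_insert hcB]
    exact ⟨adjSum_le_of_le hpos hG, eq_of_le_of_adjSum_eq hpos hG⟩
  rcases (Nat.succ_le_iff.2 hA.card_pos).eq_or_lt with hA1 | hA1
  · exact hsingle A B hAB hG hA1.symm
  rcases (Nat.succ_le_iff.2 hB.card_pos).eq_or_lt with hB1 | hB1
  · have := hsingle B A hAB.symm (splitGraph_comm A B ▸ hG) hB1.symm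
    rwa [union_comm B A] at this
  · have hlt := (adjSum_le_of_le hpos hG).trans_lt (adjSum_splitGraph_lt hg hpos hAB hcA
      (fun v hv u => hmono c v u (hmin v (mem_union_right _ hv))) hA1 hB1)
    exact ⟨c, hc, hlt.le, fun h => absurd h hlt.ne⟩

end Split

/-! ### The extremal graph -/

section Extremal

variable {n r : ℕ}

@[simp]
theorem extremalGraph_adj_inl (i : Fin r) (w : Fin r ⊕ (Fin 1 ⊕ Fin (n - r - 1))) :
    (extremalGraph n r).Adj (.inl i) w ↔ .inl i ≠ w := by
  rcases w with j | w <;> simp [extremalGraph, join]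

@[simp]
theorem extremalGraph_adj_inr (u v : Fin 1 ⊕ Fin (n - r - 1)) :
    (extremalGraph n r).Adj (.inr u) (.inr v) ↔ u ≠ v ∧ u.isLeft = v.isLeft := by
  rcases u with u | u <;> rcases v with v | v <;> simp [extremalGraph, join]

@[simp]
theorem extremalGraph_adj_inr_inl (u : Fin 1 ⊕ Fin (n - r - 1)) (i : Fin r) :
    (extremalGraph n r).Adj (.inr u) (.inl i) := by
  simp [(extremalGraph n r).adj_comm]

theorem card_extremalGraph (h : r + 2 ≤ n) :
    Fintype.card (Fin r ⊕ (Fin 1 ⊕ Fin (n - r - 1))) = n := by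
  simp only [Fintype.card_sum, Fintype.card_fin]
  omega

theorem connected_extremalGraph (hr : 1 ≤ r) : (extremalGraph n r).Connected := by
  have key : ∀ w, (extremalGraph n r).Reachable (.inl ⟨0, hr⟩) w := by
    intro w
    by_cases h : .inl ⟨0, hr⟩ = w
    · rw [h]
    · exact (extremalGraph_adj_inl _ w |>.2 h).reachable
  exact { preconnected := fun u v => (key u).symm.trans (key v), nonempty := ⟨.inl ⟨0, hr⟩⟩ }

theorem vertexConnectivity_extremalGraph (h : r + 2 ≤ n) :
    vertexConnectivity (extremalGraph n r) = r := by
  classical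
  have hn := card_extremalGraph h
  apply le_antisymm
  · refine Nat.sInf_le ⟨univ.map .inl, by simp, Or.inl fun hp => ?_⟩
    -- No edge leaves the isolated vertex once the vertices of `K_r` are removed.
    have hout : ∀ w : {v : Fin r ⊕ (Fin 1 ⊕ Fin (n - r - 1)) | v ∉ univ.map .inl},
        ((extremalGraph n r).induce _).Reachable ⟨.inr (.inl 0), by simp⟩ w →
          w.1 = .inr (.inl 0) := by
      intro w hw
      rw [SimpleGraph.reachable_iff_reflTransGen] at hw
      induction hw with
      | refl => rfl
      | tail _ hadj ih =>
        rename_i u v _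
        obtain ⟨u, hu⟩ := u
        obtain ⟨v, hv⟩ := v
        change u = _ at ih
        subst ih
        rcases v with v | v | v
        · simp at hv
        · exact congrArg (fun i => Sum.inr (Sum.inl i)) (Subsingleton.elim v 0)
        · simp at hadj
    simpa using hout ⟨.inr (.inr ⟨0, by omega⟩), by simp⟩ (hp _ _)
  · refine le_csInf ⟨_, univ, rfl, Or.inr (by rw [card_univ]; omega)⟩ ?_
    rintro k ⟨S, rfl, hS⟩
    by_contra! hlt
    rcases hS with hS | hS
    · -- A set of fewer than `r` vertices misses a vertex of `K_r`, which is adjacent to all others.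
      obtain ⟨w, hw, hwS⟩ := exists_mem_notMem_of_card_lt_card
        (s := S) (t := univ.map (.inl : Fin r ↪ Fin r ⊕ (Fin 1 ⊕ Fin (n - r - 1)))) (by simpa)
      obtain ⟨i, -, rfl⟩ := mem_map.1 hw
      have key : ∀ v, ((extremalGraph n r).induce {v | v ∉ S}).Reachable ⟨_, hwS⟩ v := by
        rintro ⟨v, hv⟩
        by_cases h : Sum.inl i = v
        · subst h; rfl
        · exact SimpleGraph.Adj.reachable (extremalGraph_adj_inl _ v |>.2 h)
      exact hS fun u v => (key u).symm.trans (key v)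
    · omega

theorem nonempty_splitGraph_iso_extremalGraph {V : Type*} [Fintype V] [DecidableEq V]
    (hV : Fintype.card V = n) (h : r + 2 ≤ n) {c : V} {R : Finset V} (hc : c ∉ R)
    (hR : #R = n - r - 1) : Nonempty (splitGraph {c} R ≃g extremalGraph n r) := by
  have hS : #(insert c R)ᶜ = r := by
    rw [card_compl, card_insert_of_notMem hc]
    omega
  let eR := (R.equivFinOfCardEq hR).symm
  let eS := ((insert c R)ᶜ.equivFinOfCardEq hS).symm
  have hmS : ∀ i, (eS i : V) ≠ c ∧ (eS i : V) ∉ R := fun i => by simpa using (eS i).2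
  have hmR : ∀ j, (eR j : V) ∈ R := fun j => (eR j).2
  have hmc : ∀ j, (eR j : V) ≠ c := fun j h => hc (h ▸ hmR j)
  let f : Fin r ⊕ (Fin 1 ⊕ Fin (n - r - 1)) → V :=
    Sum.elim (fun i => eS i) (Sum.elim (fun _ => c) fun j => eR j)
  have hf : Function.Injective f := by
    refine (Subtype.val_injective.comp eS.injective).sumElim
      (Function.Injective.sumElim (fun _ _ _ => Subsingleton.elim _ _)
        (Subtype.val_injective.comp eR.injective) fun _ j h => hmc j h.symm) ?_
    rintro i (j | j) hij
    · exact (hmS i).1 hij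
    · exact (hmS i).2 ((show (eS i : V) = eR j from hij) ▸ hmR j)
  have hb : Function.Bijective f :=
    (Fintype.bijective_iff_injective_and_card f).2 ⟨hf, by rw [card_extremalGraph h, hV]⟩
  refine ⟨(RelIso.symm ⟨Equiv.ofBijective f hb, ?_⟩)⟩
  intro u v
  change (splitGraph {c} R).Adj (f u) (f v) ↔ _
  rw [splitGraph_adj, hf.ne_iff]
  have hfS : ∀ i, f (.inl i) ≠ c ∧ f (.inl i) ∉ R := hmS
  have hfc : ∀ u, f (.inr (.inl u)) = c := fun _ => rfl
  have hfR : ∀ j, f (.inr (.inr j)) ∈ R := hmR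
  have hfRc : ∀ j, f (.inr (.inr j)) ≠ c := hmc
  clear_value f
  rcases u with i | u | j <;> rcases v with i' | v | j' <;>
    simp [hfS, hfc, hfR, hfRc, hc]

end Extremal

/-! ### Comparison of the largest eigenvalues -/

section Comparison

variable {V : Type*} {a b : ℝ}

theorem pairForm_comm (a b : ℝ) (x : V → ℝ) (u v : V) :
    pairForm a b x u v = pairForm a b x v u := by
  rw [pairForm, pairForm]; ring

theorem pairForm_pos (ha : 0 ≤ a) (hb : 0 < b) {x : V → ℝ} (hx : ∀ v, 0 < x v) (u v : V) :
    0 < pairForm a b x u v := by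
  have := hx u
  have := hx v
  unfold pairForm
  positivity

theorem pairForm_mono (ha : 0 ≤ a) (hb : 0 < b) {x : V → ℝ} (hx : ∀ v, 0 < x v) {u v : V}
    (w : V) (huv : x u ≤ x v) : pairForm a b x u w ≤ pairForm a b x v w := by
  have := (hx u).le
  have := (hx w).le
  unfold pairForm
  gcongr

variable [Fintype V] [DecidableEq V]

theorem sum_pairs_mul_eq (g : V → V → ℝ) (G : SimpleGraph V) [DecidableRel G.Adj] :
    ∑ u, ∑ v, ((if u ≠ v then 1 else 0) + if G.Adj u v then 1 else 0) / 2 * g u v =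
      (adjSum g ⊤ + adjSum g G) / 2 := by
  simp only [adjSum, ← sum_add_distrib, sum_div, SimpleGraph.top_adj]
  refine sum_congr rfl fun u _ => sum_congr rfl fun v _ => ?_
  by_cases h : u = v <;> by_cases h' : G.Adj u v <;> simp [h, h']
  ring

/-- Pairs at distance at least two contribute at most half of their weight, so the quadratic form
of `harary a b G` is controlled by the adjacency sum. -/
theorem dotProduct_harary_mulVec_le (ha : 0 ≤ a) (hb : 0 < b) {x : V → ℝ} (hx : ∀ v, 0 < x v)
    (G : SimpleGraph V) :
    4 * (x ⬝ᵥ harary a b G *ᵥ x) ≤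
      adjSum (pairForm a b x) ⊤ + adjSum (pairForm a b x) G := by
  classical
  have h := two_mul_dotProduct_harary_mulVec a b G x
  have hle : ∑ u, ∑ v, 1 / (G.dist u v : ℝ) * pairForm a b x u v ≤ _ :=
    sum_le_sum fun u _ => sum_le_sum fun v _ =>
      mul_le_mul_of_nonneg_right (one_div_dist_le G u v) (pairForm_pos ha hb hx u v).le
  rw [sum_pairs_mul_eq] at hle
  linarith

theorem dotProduct_harary_mulVec_eq {G : SimpleGraph V}
    (hG : ∀ u v, u ≠ v → ¬ G.Adj u v → ∃ c, G.Adj u c ∧ G.Adj c v) (x : V → ℝ) :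
    4 * (x ⬝ᵥ harary a b G *ᵥ x) =
      adjSum (pairForm a b x) ⊤ + adjSum (pairForm a b x) G := by
  classical
  have h := two_mul_dotProduct_harary_mulVec a b G x
  simp only [one_div_dist_eq G hG] at h
  rw [sum_pairs_mul_eq] at h
  linarith

theorem rho_harary_le_extremalGraph {n r : ℕ} (hr : 1 ≤ r) (hrn : r + 2 ≤ n) (ha : 0 ≤ a)
    (hb : 0 < b) {G : SimpleGraph V} (hV : Fintype.card V = n) (hG : G.Connected)
    (hκ : vertexConnectivity G = r) :
    rho (harary a b G) ≤ rho (harary a b (extremalGraph n r)) ∧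
      (rho (harary a b G) = rho (harary a b (extremalGraph n r)) ↔
        Nonempty (G ≃g extremalGraph n r)) := by
  have : Nonempty V := hG.nonempty
  obtain ⟨x, hx, hGx⟩ := exists_pos_harary_mulVec_eq hG ha hb
  obtain ⟨A, B, hAB, hA, hB, hcard, hle⟩ := exists_le_splitGraph (G := G) (by omega)
  obtain ⟨c, hc, hsum, hsum_eq⟩ := exists_adjSum_le_splitGraph (x := x) (pairForm_comm a b x)
    (pairForm_pos ha hb hx) (fun u v w => pairForm_mono ha hb hx w) hAB hA hB hle
  set R := (A ∪ B).erase c with hRdef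
  have hcR : c ∉ R := notMem_erase c _
  have hR : #R = n - r - 1 := by
    rw [hRdef, card_erase_of_mem hc]
    omega
  obtain ⟨e⟩ := nonempty_splitGraph_iso_extremalGraph hV hrn hcR hR
  -- The vertices outside `A ∪ B` dominate, so `splitGraph {c} R` has diameter two.
  have hdiam : ∀ u v, u ≠ v → ¬ (splitGraph {c} R).Adj u v →
      ∃ w, (splitGraph {c} R).Adj u w ∧ (splitGraph {c} R).Adj w v := by
    intro u v huv hnadj
    obtain ⟨w, hw⟩ : ∃ w, w ∉ insert c R := by
      by_contra! h
      have := card_le_card (fun w _ => h w : univ ⊆ insert c R)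
      rw [card_univ, card_insert_of_notMem hcR] at this
      omega
    simp only [mem_insert, not_or] at hw
    simp only [splitGraph_adj, mem_singleton, not_and] at hnadj ⊢
    refine ⟨w, ⟨?_, by tauto, by tauto⟩, ?_, by tauto, by tauto⟩
    · rintro rfl
      exact hw.2 (by tauto)
    · rintro rfl
      exact hw.2 (by tauto)
  have hxx : 0 < x ⬝ᵥ x :=
    sum_pos (fun v _ => mul_pos (hx v) (hx v)) univ_nonempty
  have h1 := dotProduct_harary_mulVec_le ha hb hx G
  have h2 := dotProduct_harary_mulVec_eq (a := a) (b := b) hdiam x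
  have h3 := dotProduct_mulVec_le_rho (harary_isSymm a b (splitGraph {c} R)) x
  rw [hGx, dotProduct_smul, smul_eq_mul] at h1
  rw [← rho_harary_iso a b e]
  refine ⟨le_of_mul_le_mul_right (by linarith) hxx, fun h => ?_, fun ⟨e'⟩ => ?_⟩
  · rw [h] at h1
    rw [hsum_eq (hsum.antisymm (by linarith))]
    exact ⟨e⟩
  · rw [rho_harary_iso a b e, rho_harary_iso a b e']

end Comparison

end RecipDist

theorem theorem4p1 (n r : ℕ) (hr : 1 ≤ r) (hrn : r + 2 ≤ n) :
    -- the graph `K_r ∨ (K_1 ∪ K_{n-r-1})` belongs to the class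
    (Fintype.card (Fin r ⊕ (Fin 1 ⊕ Fin (n - r - 1))) = n ∧
      (RecipDist.extremalGraph n r).Connected ∧
      RecipDist.vertexConnectivity (RecipDist.extremalGraph n r) = r) ∧
    -- it is the unique maximizer, up to isomorphism, of `ρ(RD_α(G))` in the class
    (∀ α : ℝ, 0 ≤ α → α < 1 →
      ∀ (V : Type*) [Fintype V] [DecidableEq V] (G : SimpleGraph V),
        Fintype.card V = n → G.Connected → RecipDist.vertexConnectivity G = r →
          RecipDist.rho (RecipDist.RDα α G) ≤
            RecipDist.rho (RecipDist.RDα α (RecipDist.extremalGraph n r)) ∧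
          (RecipDist.rho (RecipDist.RDα α G) =
              RecipDist.rho (RecipDist.RDα α (RecipDist.extremalGraph n r)) ↔
            Nonempty (G ≃g RecipDist.extremalGraph n r))) ∧
    -- it is the unique maximizer, up to isomorphism, of `ρ(RQ(G))` in the class
    (∀ (V : Type*) [Fintype V] [DecidableEq V] (G : SimpleGraph V),
        Fintype.card V = n → G.Connected → RecipDist.vertexConnectivity G = r →
          RecipDist.rho (RecipDist.RQ G) ≤
            RecipDist.rho (RecipDist.RQ (RecipDist.extremalGraph n r)) ∧
          (RecipDist.rho (RecipDist.RQ G) =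
              RecipDist.rho (RecipDist.RQ (RecipDist.extremalGraph n r)) ↔
            Nonempty (G ≃g RecipDist.extremalGraph n r))) := by

  refine ⟨⟨RecipDist.card_extremalGraph hrn, RecipDist.connected_extremalGraph hr,
    RecipDist.vertexConnectivity_extremalGraph hrn⟩, ?_, ?_⟩
  · intro α hα hα1 V _ _ G hV hG hκ
    exact RecipDist.rho_harary_le_extremalGraph hr hrn hα (sub_pos.2 hα1) hV hG hκ
  · intro V _ _ G hV hG hκ
    have h := RecipDist.rho_harary_le_extremalGraph hr hrn zero_le_one one_pos hV hG hκ
    simpa only [RecipDist.harary, RecipDist.RQ, one_smul] using h
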